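/- Let $n$ and $r$ be non-negative integers, and let $T$ be a real symmetric $n\times n$ matrix of full rank $n$ with distinct eigenvalues, with eigendecomposition $T=U\Sigma U^{\top}$, where $U$ is orthogonal and $\Sigma=\mathrm{diag}(\sigma_1,\dots,\sigma_n)$. For $\mathcal I\subseteq\{1,\dots,n\}$ let $\Sigma_{\mathcal I}$ be the diagonal matrix with entries $(\Sigma_{\mathcal I})_{ii}=\sigma_i$ if $i\in\mathcal I$ and $0$ otherwise, and put $S_{\mathcal I}=U\Sigma_{\mathcal I}U^{\top}$ and $\mathcal I^c=\{1,\dots,n\}\setminus\mathcal I$. Let $\mathcal S(r;n)$ be the manifold of real symmetric $n\times n$ matrices of rank exactly $r$, and let $h_T(S)=\|T-S\|_F^2$, where $\|\cdot\|_F$ is the Frobenius norm. Then: 1. The restriction $h_T|_{\mathcal S(r;n)}$ has exactly $\binom nr$ critical points (points $S\in\mathcal S(r;n)$ at which the differential of $h_T$ vanishes on all vectors tangent to $\mathcal S(r;n)$), namely the matrices $S_{\mathcal I}$ with $\#\mathcal I=r$. 2. For each $\mathcal I$ with $\#\mathcal I=r$, the index of $h_T|_{\mathcal S(r;n)}$ at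 $S_{\mathcal I}$, i.e. the number of negative eigenvalues, counted with multiplicity, of the Hessian matrix at $0$ of $h_T\circ p$ for any smooth local parameterization $p$ of $\mathcal S(r;n)$ with $p(0)=S_{\mathcal I}$, is $$\#\left\{(i,j)\in\mathcal I\times\mathcal I^c : 0\le \frac{\sigma_i}{\sigma_j}\le 1\right\}.$$ -/

import Mathlib

open scoped ContDiff

-- Spaces of real matrices carry the Frobenius norm throughout.
attribute [local instance] Matrix.frobeniusNormedAddCommGroup Matrix.frobeniusNormedSpace

namespace EckartYoung

noncomputable section

section Geometry

variable {E : Type*} [NormedAddCommGroup E] [NormedSpace ℝ E]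

/-- The map `p`, considered on `U`, is a smooth local parameterization (the inverse of a chart)
of `X ⊆ E` centred at `s`: the set `U ⊆ ℝᵈ` is an open neighbourhood of `0`, `p 0 = s`, and `p`
is a diffeomorphism from `U` onto a relatively open subset `X ∩ V` of `X` (the inverse is the
restriction of a smooth map `q` defined on the open set `V` of the ambient space). -/
structure IsLocalParam (X : Set E) (s : E) {d : ℕ} (U : Set (EuclideanSpace ℝ (Fin d)))
    (p : EuclideanSpace ℝ (Fin d) → E) : Prop where
  isOpen : IsOpen U
  zero_mem : 0 ∈ U
  map_zero : p 0 = s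
  smooth : ContDiffOn ℝ ∞ p U
  exists_inverse : ∃ (V : Set E) (q : E → EuclideanSpace ℝ (Fin d)),
    IsOpen V ∧ p '' U = X ∩ V ∧ ContDiffOn ℝ ∞ q V ∧ ∀ u ∈ U, q (p u) = u

/-- Tangent vectors to `X ⊆ E` at `s`: velocities at time `0` of smooth curves in `X` through
`s`. At a point where `X` is a smooth submanifold this is the embedded tangent space. -/
def tangentVectors (X : Set E) (s : E) : Set E :=
  {v | ∃ (ε : ℝ) (γ : ℝ → E), 0 < ε ∧ ContDiffOn ℝ ∞ γ (Set.Ioo (-ε) ε) ∧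
    (∀ t ∈ Set.Ioo (-ε) ε, γ t ∈ X) ∧ γ 0 = s ∧ HasDerivAt γ v 0}

/-- For a smooth function `L` on `E`: `s` is a critical point of the restriction of `L` to `X`,
i.e. the differential of `L` at `s` vanishes in all directions tangent to `X`. -/
def IsCriticalPointOn (L : E → ℝ) (X : Set E) (s : E) : Prop :=
  s ∈ X ∧ ∀ v ∈ tangentVectors X s, fderiv ℝ L s v = 0

/-- The Hessian matrix of second partial derivatives of `f : ℝᵈ → ℝ` at `x`. -/
def hessianMatrix {d : ℕ} (f : EuclideanSpace ℝ (Fin d) → ℝ) (x : EuclideanSpace ℝ (Fin d)) :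
    Matrix (Fin d) (Fin d) ℝ :=
  Matrix.of fun i j =>
    fderiv ℝ (fderiv ℝ f) x (EuclideanSpace.single i 1) (EuclideanSpace.single j 1)

/-- The number of negative real eigenvalues of a square matrix, with (algebraic)
multiplicity. -/
def numNegEigenvalues {d : ℕ} (H : Matrix (Fin d) (Fin d) ℝ) : ℕ :=
  (H.charpoly.roots.filter (fun x => x < 0)).card

/-- The Morse index at `s` of the restriction of `L` to `X` is `k`: the set `X` has a smooth
local parameterization at `s`, and for every such parameterization `p` the Hessian matrix of
`L ∘ p` at `0` has exactly `k` negative eigenvalues, counted with multiplicity. -/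
def HasMorseIndexOn (L : E → ℝ) (X : Set E) (s : E) (k : ℕ) : Prop :=
  (∃ (d : ℕ) (U : Set (EuclideanSpace ℝ (Fin d))) (p : EuclideanSpace ℝ (Fin d) → E),
    IsLocalParam X s U p) ∧
  ∀ (d : ℕ) (U : Set (EuclideanSpace ℝ (Fin d))) (p : EuclideanSpace ℝ (Fin d) → E),
    IsLocalParam X s U p → numNegEigenvalues (hessianMatrix (L ∘ p) 0) = k

end Geometry

/-- The set of real symmetric `n × n` matrices of rank exactly `r`. -/
def symRank (r n : ℕ) : Set (Matrix (Fin n) (Fin n) ℝ) :=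
  {S | S.IsSymm ∧ S.rank = r}

/-- The squared Frobenius distance to `T`. -/
def sqDist {n : ℕ} (T S : Matrix (Fin n) (Fin n) ℝ) : ℝ := ‖T - S‖ ^ 2

/-- The matrix `U Σ_I Uᵀ`, where `Σ_I` is the diagonal matrix whose `i`-th diagonal entry is
`σ i` if `i ∈ I`, and `0` otherwise. -/
def partialSum {n : ℕ} (U : Matrix (Fin n) (Fin n) ℝ) (σ : Fin n → ℝ) (I : Finset (Fin n)) :
    Matrix (Fin n) (Fin n) ℝ :=
  U * Matrix.diagonal (fun i => if i ∈ I then σ i else 0) * U.transpose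

end

end EckartYoung

/-! Let P be the orthogonal projection onto the range of S and Q = 1 - P. A matrix Z whose
compression PZP is invertible on the range of P has the rank of P exactly when QZQ = QZP(PZP)⁻¹PZQ
(`rank_eq_rank_iff`). So near S the symmetric matrices of rank r form the graph of a smooth function
over the space of symmetric V with QVQ = 0. This gives both a chart (`exists_isLocalParam`) and the
tangent space.

Critical points: the differential of the squared distance at S is v ↦ -2⟨T - S, v⟩. Testing it on
the directions XS + SXᵀ forces S(T - S) = 0. Then S commutes with T, so distinct eigenvalues make S
diagonal in the eigenbasis, and each diagonal entry is 0 or σ_i. Conversely, T - S_I = QTQ is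
orthogonal to every v with QvQ = 0.

Index: along a curve γ of constant rank through S_I, the increment of the squared distance is ‖γ -
S_I‖² - 2⟨T, QγQ⟩, and the Schur formula makes QγQ a second-order term determined by the velocity v
alone. With W = UᵀvU the t²-coefficient is Σ_{i,j∈I} W_ij² + 2 Σ_{i∈I, j∉I} (1 - σ_j/σ_i) W_ij²
(`hessianForm_eq_sum`). A pair contributes a negative direction iff σ_j/σ_i > 1, i.e. 0 < σ_i/σ_j <
1. The inertia argument `numNegEigenvalues_eq_of_maps` transfers this count to the Hessian matrix in
any parameterization. -/

namespace EckartYoung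

section

open Filter Topology Matrix

/-! ### Second derivatives along lines and inertia of symmetric matrices -/

/-- A second-order expansion along a line determines the second derivative in its direction. -/
theorem snd_fderiv_apply_of_tendsto {E : Type*} [NormedAddCommGroup E] [NormedSpace ℝ E]
    {f : E → ℝ} (hf : ContDiffAt ℝ 2 f 0) {v : E} {k : ℝ}
    (h : Tendsto (fun t : ℝ => (f (t • v) - f 0) / t ^ 2) (𝓝[≠] 0) (𝓝 k)) :
    fderiv ℝ (fderiv ℝ f) 0 v v = 2 * k := by
  have hline : HasDerivAt (fun t : ℝ => t • v) v 0 := by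
    simpa using (hasDerivAt_id (0 : ℝ)).smul_const v
  have htend : Tendsto (fun t : ℝ => t • v) (𝓝 0) (𝓝 (0 : E)) := by
    simpa using hline.continuousAt.tendsto
  have hdiff : ∀ᶠ x in 𝓝 (0 : E), DifferentiableAt ℝ f x := by
    filter_upwards [hf.eventually (by simp)] with x hx
    exact hx.differentiableAt (by simp)
  have hg : ∀ᶠ t : ℝ in 𝓝 0, HasDerivAt (fun t : ℝ => f (t • v) - f 0) (fderiv ℝ f (t • v) v) t := by
    filter_upwards [htend.eventually hdiff] with t ht
    have h1 : HasDerivAt (fun t : ℝ => t • v) v t := by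
      simpa using (hasDerivAt_id t).smul_const v
    exact (ht.hasFDerivAt.comp_hasDerivAt t h1).sub_const _
  have hf' : DifferentiableAt ℝ (fderiv ℝ f) 0 :=
    (hf.fderiv_right (m := 1) (by norm_num)).differentiableAt (by simp)
  have hg' : HasDerivAt (fun t : ℝ => fderiv ℝ f (t • v) v) (fderiv ℝ (fderiv ℝ f) 0 v v) 0 := by
    have h0 : HasFDerivAt (fderiv ℝ f) (fderiv ℝ (fderiv ℝ f) 0) ((0 : ℝ) • v) := by
      simpa using hf'.hasFDerivAt
    have h1 := h0.comp_hasDerivAt (0 : ℝ) hline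
    simpa using h1.clm_apply (hasDerivAt_const (0 : ℝ) v)
  have hne : Tendsto (fun t : ℝ => t) (𝓝[≠] 0) (𝓝 0) := tendsto_id.mono_left nhdsWithin_le_nhds
  -- A finite limit of the quotient by t² forces the first-order term to vanish, so criticality need
  -- not be assumed.
  have hzero : fderiv ℝ f 0 v = 0 := by
    have h1 := hg.self_of_nhds
    rw [hasDerivAt_iff_tendsto_slope] at h1
    have h2 := hne.mul h
    rw [zero_mul] at h2
    have h3 : Tendsto (slope (fun t : ℝ => f (t • v) - f 0) 0) (𝓝[≠] 0) (𝓝 0) := by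
      refine h2.congr' ?_
      filter_upwards [self_mem_nhdsWithin] with t ht
      have ht : t ≠ 0 := ht
      simp only [slope_def_field, zero_smul, sub_self, sub_zero]
      field_simp
    simpa using tendsto_nhds_unique h1 h3
  have hquot : Tendsto (fun t : ℝ => fderiv ℝ f (t • v) v / (2 * t)) (𝓝[≠] 0)
      (𝓝 (fderiv ℝ (fderiv ℝ f) 0 v v / 2)) := by
    have h1 := (hasDerivAt_iff_tendsto_slope.mp hg').div_const 2
    refine h1.congr' ?_
    filter_upwards with t
    simp only [slope_def_field, zero_smul, hzero, sub_zero]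
    rw [div_div, mul_comm]
  have hlim : Tendsto (fun t : ℝ => (f (t • v) - f 0) / t ^ 2) (𝓝[≠] 0)
      (𝓝 (fderiv ℝ (fderiv ℝ f) 0 v v / 2)) := by
    refine HasDerivAt.lhopital_zero_nhdsNE (f' := fun t => fderiv ℝ f (t • v) v)
      (g' := fun t => 2 * t) (hg.filter_mono nhdsWithin_le_nhds) ?_ ?_ ?_ ?_ hquot
    · filter_upwards with t
      simpa using hasDerivAt_pow 2 t
    · filter_upwards [self_mem_nhdsWithin] with t ht
      exact mul_ne_zero two_ne_zero ht
    · have := hg.self_of_nhds.continuousAt.tendsto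
      simp only [zero_smul, sub_self] at this
      exact this.mono_left nhdsWithin_le_nhds
    · simpa using hne.pow 2
  linarith [tendsto_nhds_unique h hlim]

/-- A quadratic form in an orthonormal eigenbasis. -/
theorem dotProduct_mulVec_eq_sum_eigenvalues {d : ℕ} {H : Matrix (Fin d) (Fin d) ℝ}
    (hH : H.IsHermitian) (v : Fin d → ℝ) :
    v ⬝ᵥ H *ᵥ v = ∑ k, hH.eigenvalues k *
      (((hH.eigenvectorUnitary : Matrix (Fin d) (Fin d) ℝ)ᵀ *ᵥ v) k) ^ 2 := by
  set C : Matrix (Fin d) (Fin d) ℝ := hH.eigenvectorUnitary.1 with hC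
  have hs : H = C * diagonal hH.eigenvalues * Cᵀ := by
    have := hH.spectral_theorem
    rw [Unitary.conjStarAlgAut_apply] at this
    simpa [star_eq_conjTranspose, Function.comp_def] using this
  have h1 : v ⬝ᵥ H *ᵥ v = (Cᵀ *ᵥ v) ⬝ᵥ (diagonal hH.eigenvalues *ᵥ (Cᵀ *ᵥ v)) := by
    conv_lhs => rw [hs]
    rw [← mulVec_mulVec, ← mulVec_mulVec, dotProduct_mulVec, ← mulVec_transpose]
  rw [h1, dotProduct]
  refine Finset.sum_congr rfl fun k _ => ?_
  rw [mulVec_diagonal]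
  ring

theorem numNegEigenvalues_eq_card {d : ℕ} {H : Matrix (Fin d) (Fin d) ℝ} (hH : H.IsHermitian) :
    numNegEigenvalues H = Fintype.card {k // hH.eigenvalues k < 0} := by
  rw [numNegEigenvalues, hH.roots_charpoly_eq_eigenvalues, Multiset.filter_map, Multiset.card_map,
    Fintype.card_subtype]
  rfl

/-- Inertia: a symmetric matrix that is negative definite on the image of `s : ℝᴰ → ℝᵈ` and
nonnegative on the kernel of `e : ℝᵈ → ℝᴰ` has exactly `#D` negative eigenvalues. -/
theorem numNegEigenvalues_eq_of_maps {d : ℕ} {H : Matrix (Fin d) (Fin d) ℝ} (hH : H.IsHermitian)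
    {D : Type*} [Fintype D] (e : (Fin d → ℝ) →ₗ[ℝ] (D → ℝ)) (s : (D → ℝ) →ₗ[ℝ] (Fin d → ℝ))
    (he : ∀ v, e v = 0 → 0 ≤ v ⬝ᵥ H *ᵥ v) (hs : ∀ x, x ≠ 0 → s x ⬝ᵥ H *ᵥ s x < 0) :
    numNegEigenvalues H = Fintype.card D := by
  rw [numNegEigenvalues_eq_card hH]
  set C : Matrix (Fin d) (Fin d) ℝ := hH.eigenvectorUnitary.1 with hC
  have hCC : Cᵀ * C = 1 := by
    simpa [star_eq_conjTranspose] using (Unitary.mem_iff.mp hH.eigenvectorUnitary.2).1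
  have hq := dotProduct_mulVec_eq_sum_eigenvalues hH
  rw [← hC] at hq
  apply le_antisymm
  -- Upper bound: the span of the negative eigenvectors meets the kernel of `e` only in 0, so `e`
  -- embeds it in ℝᴰ.
  · let ι : ({k // hH.eigenvalues k < 0} → ℝ) →ₗ[ℝ] (Fin d → ℝ) :=
      Function.ExtendByZero.linearMap ℝ Subtype.val
    have hinj : Function.Injective (e ∘ₗ C.mulVecLin ∘ₗ ι) := by
      rw [← LinearMap.ker_eq_bot, LinearMap.ker_eq_bot']
      intro y hy
      have h1 := he _ hy
      rw [hq, LinearMap.comp_apply, mulVecLin_apply, mulVec_mulVec, hCC, one_mulVec] at h1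
      have hval : ∀ k : {k // hH.eigenvalues k < 0}, ι y k = y k := fun k =>
        Subtype.val_injective.extend_apply _ _ _
      have hval0 : ∀ k, ¬ hH.eigenvalues k < 0 → ι y k = 0 := fun k hk =>
        Function.extend_apply' _ _ _ fun ⟨a, ha⟩ => hk (ha ▸ a.2)
      have hle : ∀ k ∈ Finset.univ, hH.eigenvalues k * ι y k ^ 2 ≤ 0 := by
        intro k _
        by_cases hk : hH.eigenvalues k < 0
        · exact mul_nonpos_of_nonpos_of_nonneg hk.le (sq_nonneg _)
        · simp [hval0 k hk]
      have h0 := (Finset.sum_eq_zero_iff_of_nonpos hle).mp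
        (le_antisymm (Finset.sum_nonpos hle) h1)
      ext k
      have := h0 k (Finset.mem_univ _)
      rw [hval] at this
      simpa [k.2.ne] using this
    simpa using LinearMap.finrank_le_finrank_of_injective hinj
  -- Lower bound: a vector in the image of `s` with no component along the negative eigenvectors
  -- would have a nonnegative form value.
  · let π : (Fin d → ℝ) →ₗ[ℝ] ({k // hH.eigenvalues k < 0} → ℝ) :=
      LinearMap.funLeft ℝ ℝ Subtype.val
    have hinj : Function.Injective (π ∘ₗ Cᵀ.mulVecLin ∘ₗ s) := by
      rw [← LinearMap.ker_eq_bot, LinearMap.ker_eq_bot']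
      intro x hx
      by_contra hne
      refine (hs x hne).not_ge ?_
      rw [hq]
      refine Finset.sum_nonneg fun k _ => ?_
      by_cases hk : hH.eigenvalues k < 0
      · have : (Cᵀ *ᵥ s x) k = 0 := congrFun hx ⟨k, hk⟩
        simp [this]
      · exact mul_nonneg (not_lt.mp hk) (sq_nonneg _)
    simpa using LinearMap.finrank_le_finrank_of_injective hinj

theorem dotProduct_hessianMatrix_mulVec {d : ℕ} (f : EuclideanSpace ℝ (Fin d) → ℝ)
    (x v : EuclideanSpace ℝ (Fin d)) :
    v.ofLp ⬝ᵥ hessianMatrix f x *ᵥ v.ofLp = fderiv ℝ (fderiv ℝ f) x v v := by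
  have hv : v = ∑ i, v i • EuclideanSpace.single i (1 : ℝ) := by
    simpa using ((EuclideanSpace.basisFun (Fin d) ℝ).sum_repr v).symm
  conv_rhs => rw [hv]
  simp only [map_sum, map_smul, _root_.sum_apply, _root_.smul_apply,
    smul_eq_mul, dotProduct, mulVec, hessianMatrix, of_apply, Finset.mul_sum]
  rw [Finset.sum_comm]
  refine Finset.sum_congr rfl fun i _ => Finset.sum_congr rfl fun j _ => ?_
  ring

theorem isHermitian_hessianMatrix {d : ℕ} {f : EuclideanSpace ℝ (Fin d) → ℝ}
    {x : EuclideanSpace ℝ (Fin d)} (hf : ContDiffAt ℝ 2 f x) : (hessianMatrix f x).IsHermitian := by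
  ext i j
  exact (hf.isSymmSndFDerivAt (by simp)) _ _

/-! ### Matrices of constant rank via Schur complements -/

section ConstantRank

attribute [local instance] Matrix.frobeniusNormedRing Matrix.frobeniusNormedAlgebra

variable {n : ℕ}

theorem hasDerivAt_add_smul {E : Type*} [NormedAddCommGroup E] [NormedSpace ℝ E] (x v : E) :
    HasDerivAt (fun t : ℝ => x + t • v) v 0 := by
  simpa only [one_smul, id] using ((hasDerivAt_id (0 : ℝ)).smul_const v).const_add x

/-- The compression of `Z` to the range of the idempotent `P`, completed by the identity on the
kernel of `P`. -/
def pivot (P Z : Matrix (Fin n) (Fin n) ℝ) : Matrix (Fin n) (Fin n) ℝ :=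
  P * Z * P + (1 - P)

/-- The value that the compression of `Z` to the kernel of `P` must have for `Z` to have the rank
of `P`. -/
noncomputable def schurTerm (P Z : Matrix (Fin n) (Fin n) ℝ) : Matrix (Fin n) (Fin n) ℝ :=
  (1 - P) * Z * P * (pivot P Z)⁻¹ * (P * Z * (1 - P))

/-- The range of P + C contains that of P, so equal ranks make the two ranges coincide. Every (P +
C)x is then fixed by P, while P(P + C)x = Px, whence Cx = 0. -/
theorem rank_add_eq_iff {P C : Matrix (Fin n) (Fin n) ℝ} (hP : P * P = P) (hPC : P * C = 0)
    (hCP : C * P = 0) : (P + C).rank = P.rank ↔ C = 0 := by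
  refine ⟨fun h => ?_, fun h => by rw [h, add_zero]⟩
  have hle : LinearMap.range P.mulVecLin ≤ LinearMap.range (P + C).mulVecLin := by
    rintro _ ⟨x, rfl⟩
    refine ⟨P *ᵥ x, ?_⟩
    rw [mulVecLin_apply, mulVecLin_apply, mulVec_mulVec, add_mul, hP, hCP, add_zero]
  have heq := Submodule.eq_of_le_of_finrank_eq hle h.symm
  refine ext_of_mulVec_single fun i => ?_
  set x : Fin n → ℝ := Pi.single i 1
  obtain ⟨y, hy⟩ : (P + C) *ᵥ x ∈ LinearMap.range P.mulVecLin := heq ▸ ⟨x, rfl⟩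
  have h1 : P *ᵥ ((P + C) *ᵥ x) = (P + C) *ᵥ x := by
    rw [← hy, mulVecLin_apply, mulVec_mulVec, hP]
  rw [mulVec_mulVec, mul_add, hP, hPC, add_zero, add_mulVec] at h1
  simpa using h1

section Idempotent

variable {P Z : Matrix (Fin n) (Fin n) ℝ}

theorem mul_pivot (hP : P * P = P) : P * pivot P Z = P * Z * P := by
  rw [pivot, mul_add, mul_sub, hP, ← mul_assoc, ← mul_assoc, hP]; simp

theorem pivot_mul (hP : P * P = P) : pivot P Z * P = P * Z * P := by
  rw [pivot, add_mul, sub_mul, hP, mul_assoc, hP]; simp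

theorem pivot_mul_compl (hP : P * P = P) : pivot P Z * (1 - P) = 1 - P := by
  rw [mul_sub, pivot_mul hP, pivot]; simp

/-- The pivot is block diagonal: PZP on the range of P and the identity on its kernel. Its inverse
has the same shape and plays the role of (PZP)⁻¹ without leaving n × n matrices. -/
theorem commute_inv_pivot (hP : P * P = P) (hN : IsUnit (pivot P Z)) :
    P * (pivot P Z)⁻¹ = (pivot P Z)⁻¹ * P := by
  have hdet := (isUnit_iff_isUnit_det _).mp hN
  calc P * (pivot P Z)⁻¹ = (pivot P Z)⁻¹ * (pivot P Z * P) * (pivot P Z)⁻¹ := by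
        rw [nonsing_inv_mul_cancel_left _ _ hdet]
    _ = (pivot P Z)⁻¹ * P := by
        rw [pivot_mul hP, ← mul_pivot hP, mul_assoc, mul_assoc, mul_nonsing_inv _ hdet, mul_one]

theorem inv_pivot_mul_compress (hP : P * P = P) (hN : IsUnit (pivot P Z)) :
    (pivot P Z)⁻¹ * (P * Z * P) = P := by
  rw [← pivot_mul hP, nonsing_inv_mul_cancel_left _ _ ((isUnit_iff_isUnit_det _).mp hN)]

theorem compress_mul_inv_pivot (hP : P * P = P) (hN : IsUnit (pivot P Z)) :
    P * Z * P * (pivot P Z)⁻¹ = P := by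
  rw [← mul_pivot hP, mul_nonsing_inv_cancel_right _ _ ((isUnit_iff_isUnit_det _).mp hN)]

theorem inv_pivot_mul_compl (hP : P * P = P) (hN : IsUnit (pivot P Z)) :
    (pivot P Z)⁻¹ * (1 - P) = 1 - P := by
  conv_lhs => rw [← pivot_mul_compl (Z := Z) hP]
  rw [nonsing_inv_mul_cancel_left _ _ ((isUnit_iff_isUnit_det _).mp hN)]

/-- Schur complement criterion for the rank, relative to an idempotent `P`. -/
theorem rank_eq_rank_iff (hP : P * P = P) (hN : IsUnit (pivot P Z)) :
    Z.rank = P.rank ↔ (1 - P) * Z * (1 - P) = schurTerm P Z := by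
  have hdet := (isUnit_iff_isUnit_det _).mp hN
  obtain ⟨Q, hQ⟩ : ∃ Q, Q = 1 - P := ⟨_, rfl⟩
  obtain ⟨M, hM⟩ : ∃ M, M = (pivot P Z)⁻¹ := ⟨_, rfl⟩
  have hPM := commute_inv_pivot hP hN
  have h1 := inv_pivot_mul_compress hP hN
  have h2 := compress_mul_inv_pivot hP hN
  have hMQ := inv_pivot_mul_compl hP hN
  have hPQ : P * Q = 0 := by rw [hQ, mul_sub, hP, mul_one, sub_self]
  have hQP : Q * P = 0 := by rw [hQ, sub_mul, hP, one_mul, sub_self]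
  have hsum : P = 1 - Q := by rw [hQ]; abel
  have hMu : IsUnit M.det := by rw [hM]; exact isUnit_nonsing_inv_det _ hdet
  rw [schurTerm]
  rw [← hM] at hPM h1 h2 hMQ ⊢
  rw [← hQ] at hMQ ⊢
  -- Block Gaussian elimination: 1 - A clears the QP block and 1 - B the PQ block, leaving PZP + C
  -- with C the Schur complement. Both factors are invertible because A and B square to zero;
  -- multiplying by M then normalizes PZP to P.
  set A := Q * Z * P * M with hA
  set B := M * (P * Z * Q) with hB
  set C := Q * Z * Q - A * (P * Z * Q) with hC
  have hAQ : A * Q = 0 := by rw [hA, mul_assoc, hMQ, mul_assoc, hPQ, mul_zero]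
  have hQB : Q * B = 0 := by
    have : B = P * B := by rw [hB, ← mul_assoc P, hPM, mul_assoc M, ← mul_assoc P, ← mul_assoc P, hP]
    rw [this, ← mul_assoc, hQP, zero_mul]
  have hAA : A * A = 0 := by
    conv_lhs => rhs; rw [hA, mul_assoc, mul_assoc]
    rw [← mul_assoc, hAQ, zero_mul]
  have hBB : B * B = 0 := by
    conv_lhs => lhs; rw [hB, ← mul_assoc]
    rw [mul_assoc, hQB, mul_zero]
  have hL : IsUnit (1 - A).det := by
    rw [← isUnit_iff_isUnit_det]
    exact IsNilpotent.isUnit_one_sub ⟨2, by rw [pow_two, hAA]⟩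
  have hR : IsUnit (1 - B).det := by
    rw [← isUnit_iff_isUnit_det]
    exact IsNilpotent.isUnit_one_sub ⟨2, by rw [pow_two, hBB]⟩
  have hAP : A * P = A := by rw [hsum, mul_sub, hAQ, mul_one, sub_zero]
  have hPB : P * B = B := by rw [hsum, sub_mul, hQB, one_mul, sub_zero]
  have hPC : P * C = 0 := by
    rw [hC, hA, mul_sub]
    simp only [← mul_assoc, hPQ, zero_mul, sub_self]
  have hCP : C * P = 0 := by
    rw [hC, sub_mul]
    simp only [mul_assoc, hQP, mul_zero, sub_self]
  have hMC : M * C = C := by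
    rw [hC, hA, mul_sub]
    simp only [← mul_assoc, hMQ]
  have hLZ : (1 - A) * Z = P * Z + C := by
    have e1 : A * (P * Z * P) = Q * Z * P := by rw [hA, mul_assoc, h1, mul_assoc, hP]
    have e2 : A * Z = A * (P * Z * P) + A * (P * Z * Q) := by
      rw [← mul_add, ← mul_add, hQ, add_sub_cancel, mul_one, ← mul_assoc, hAP]
    rw [sub_mul, e2, e1, hC, hsum]
    noncomm_ring
  have hLZR : (1 - A) * Z * (1 - B) = P * Z * P + C := by
    have e1 : C * B = 0 := by rw [← hPB, ← mul_assoc, hCP, zero_mul]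
    have e2 : P * Z * B = P * Z * Q := by
      rw [← hPB, ← mul_assoc, hB, ← mul_assoc, h2, ← mul_assoc, ← mul_assoc, hP]
    rw [hLZ, mul_sub, mul_one, add_mul (P * Z) C B, e1, e2, hQ]
    noncomm_ring
  have hMLZR : M * ((1 - A) * Z * (1 - B)) = P + C := by rw [hLZR, mul_add, h1, hMC]
  have hrank : Z.rank = (P + C).rank := by
    rw [← hMLZR, rank_mul_eq_right_of_isUnit_det _ _ hMu, rank_mul_eq_left_of_isUnit_det _ _ hR,
      rank_mul_eq_right_of_isUnit_det _ _ hL]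
  rw [hrank, rank_add_eq_iff hP hPC hCP, hC, sub_eq_zero]

end Idempotent

/-! ### Tangent vectors and expansions along curves -/

/-- The velocity comes from the congruences (1 + tX) S (1 + tX)ᵀ, which preserve symmetry, and also
the rank while 1 + tX is invertible. -/
theorem mul_add_mul_transpose_mem_tangentVectors {r : ℕ} {S : Matrix (Fin n) (Fin n) ℝ}
    (hS : S ∈ symRank r n) (X : Matrix (Fin n) (Fin n) ℝ) :
    X * S + S * Xᵀ ∈ tangentVectors (symRank r n) S := by
  have hcont : Continuous fun t : ℝ => (1 + t • X).det := by fun_prop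
  have hev : ∀ᶠ t : ℝ in 𝓝 0, (1 + t • X).det ≠ 0 :=
    hcont.continuousAt.eventually_ne (by simp)
  obtain ⟨ε, hε, hball⟩ := Metric.eventually_nhds_iff_ball.mp hev
  refine ⟨ε, fun t => (1 + t • X) * S * (1 + t • Xᵀ), hε, ?_, ?_, by simp, ?_⟩
  · exact ContDiff.contDiffOn (by fun_prop)
  · intro t ht
    have hu : IsUnit (1 + t • X).det := by
      refine (hball t ?_).isUnit
      rwa [Real.ball_eq_Ioo, zero_sub, zero_add]
    have htr : 1 + t • Xᵀ = (1 + t • X)ᵀ := by simp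
    refine ⟨?_, ?_⟩
    · have := hS.1.eq
      simp [IsSymm, transpose_mul, this, mul_assoc]
    · show ((1 + t • X) * S * (1 + t • Xᵀ)).rank = r
      rw [htr, rank_mul_eq_left_of_isUnit_det _ _ (by rwa [det_transpose]),
        rank_mul_eq_right_of_isUnit_det _ _ hu, hS.2]
  · have h1 : ∀ Y : Matrix (Fin n) (Fin n) ℝ, HasDerivAt (fun t : ℝ => 1 + t • Y) Y 0 :=
      hasDerivAt_add_smul 1
    have h2 := ((h1 X).mul_const S).mul (h1 Xᵀ)
    simp only [zero_smul, add_zero, mul_one, one_mul] at h2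
    exact h2

/-- Since QS = SQ = 0, the two outer factors of the Schur term are each t times a compressed
difference quotient. One derivative of γ therefore determines QγQ to second order. -/
theorem tendsto_smul_schurTerm {P S v : Matrix (Fin n) (Fin n) ℝ}
    {γ : ℝ → Matrix (Fin n) (Fin n) ℝ} (hP : P * P = P) (hPS : P * S = S) (hSP : S * P = S)
    (hN : IsUnit (pivot P S)) (hγ0 : γ 0 = S) (hγ : HasDerivAt γ v 0)
    (hrank : ∀ᶠ t in 𝓝 0, (γ t).rank = P.rank) :
    Tendsto (fun t : ℝ => (t ^ 2)⁻¹ • ((1 - P) * γ t * (1 - P))) (𝓝[≠] 0)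
      (𝓝 ((1 - P) * v * P * (pivot P S)⁻¹ * (P * v * (1 - P)))) := by
  have hcγ : Tendsto γ (𝓝 0) (𝓝 S) := hγ0 ▸ hγ.continuousAt.tendsto
  have hpiv : Tendsto (fun t => pivot P (γ t)) (𝓝 0) (𝓝 (pivot P S)) :=
    ((hcγ.const_mul P).mul_const P).add_const _
  have hunit : ∀ᶠ t in 𝓝 0, IsUnit (pivot P (γ t)) :=
    hpiv.eventually (Units.isOpen.mem_nhds hN)
  have hinv : Tendsto (fun t => (pivot P (γ t))⁻¹) (𝓝 0) (𝓝 (pivot P S)⁻¹) := by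
    obtain ⟨u, hu⟩ := hN
    simp only [nonsing_inv_eq_ringInverse]
    have := (NormedRing.inverse_continuousAt u).tendsto
    rw [hu] at this
    exact this.comp hpiv
  have hslope := hasDerivAt_iff_tendsto_slope.mp hγ
  have hlim : Tendsto (fun t => (1 - P) * slope γ 0 t * P * (pivot P (γ t))⁻¹ *
      (P * slope γ 0 t * (1 - P))) (𝓝[≠] 0)
      (𝓝 ((1 - P) * v * P * (pivot P S)⁻¹ * (P * v * (1 - P)))) :=
    (((hslope.const_mul _).mul_const _).mul (hinv.mono_left nhdsWithin_le_nhds)).mul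
      ((hslope.const_mul _).mul_const _)
  refine hlim.congr' ?_
  filter_upwards [nhdsWithin_le_nhds hrank, nhdsWithin_le_nhds hunit] with t hr hu
  rw [(rank_eq_rank_iff hP hu).mp hr, schurTerm]
  have hQS : (1 - P) * S = 0 := by rw [sub_mul, hPS, one_mul, sub_self]
  have hSQ : S * (1 - P) = 0 := by rw [mul_sub, hSP, mul_one, sub_self]
  have e1 : (1 - P) * slope γ 0 t = t⁻¹ • ((1 - P) * γ t) := by
    rw [slope_def_module, hγ0, sub_zero, mul_smul_comm, mul_sub, hQS, sub_zero]
  have e2 : P * slope γ 0 t * (1 - P) = t⁻¹ • (P * γ t * (1 - P)) := by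
    rw [slope_def_module, hγ0, sub_zero, mul_smul_comm, smul_mul_assoc, mul_assoc, sub_mul, hSQ,
      sub_zero, mul_assoc]
  rw [e1, e2]
  simp only [smul_mul_assoc, mul_smul_comm, smul_smul]
  congr 1
  rw [pow_two, mul_inv]

/-- The block QγQ is O(t²), so its velocity is zero. -/
theorem compl_mul_deriv_mul_compl {P S v : Matrix (Fin n) (Fin n) ℝ}
    {γ : ℝ → Matrix (Fin n) (Fin n) ℝ} (hP : P * P = P) (hPS : P * S = S) (hSP : S * P = S)
    (hN : IsUnit (pivot P S)) (hγ0 : γ 0 = S) (hγ : HasDerivAt γ v 0)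
    (hrank : ∀ᶠ t in 𝓝 0, (γ t).rank = P.rank) : (1 - P) * v * (1 - P) = 0 := by
  have hne : Tendsto (fun t : ℝ => t) (𝓝[≠] 0) (𝓝 0) := tendsto_id.mono_left nhdsWithin_le_nhds
  have h1 := hne.smul (tendsto_smul_schurTerm hP hPS hSP hN hγ0 hγ hrank)
  rw [zero_smul] at h1
  have h2 : Tendsto (fun t => (1 - P) * slope γ 0 t * (1 - P)) (𝓝[≠] 0)
      (𝓝 ((1 - P) * v * (1 - P))) :=
    ((hasDerivAt_iff_tendsto_slope.mp hγ).const_mul _).mul_const _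
  refine tendsto_nhds_unique h2 (h1.congr' ?_)
  filter_upwards [self_mem_nhdsWithin] with t ht
  have ht : t ≠ 0 := ht
  have hQS : (1 - P) * S = 0 := by rw [sub_mul, hPS, one_mul, sub_self]
  rw [slope_def_module, hγ0, sub_zero, mul_smul_comm, smul_mul_assoc, mul_sub (1 - P) (γ t) S,
    hQS, sub_zero, smul_smul]
  congr 1
  field_simp

theorem isSymm_deriv {v : Matrix (Fin n) (Fin n) ℝ} {γ : ℝ → Matrix (Fin n) (Fin n) ℝ}
    (hγ : HasDerivAt γ v 0) (hsymm : ∀ᶠ t in 𝓝 0, (γ t).IsSymm) : v.IsSymm := by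
  let τ : Matrix (Fin n) (Fin n) ℝ →L[ℝ] Matrix (Fin n) (Fin n) ℝ :=
    (transposeLinearEquiv (Fin n) (Fin n) ℝ ℝ).toLinearMap.toContinuousLinearMap
  have h1 : HasDerivAt (fun t => τ (γ t)) (τ v) 0 := τ.hasFDerivAt.comp_hasDerivAt 0 hγ
  exact (h1.congr_of_eventuallyEq (hsymm.mono fun t ht => ht.eq.symm)).unique hγ

/-! ### The squared distance -/

theorem sqDist_eq_sum (T S : Matrix (Fin n) (Fin n) ℝ) :
    sqDist T S = ∑ i, ∑ j, (T i j - S i j) ^ 2 := by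
  rw [sqDist, frobenius_norm_def, ← Real.sqrt_eq_rpow, Real.sq_sqrt]
  · simp
  · positivity

theorem sqDist_eq_trace (T S : Matrix (Fin n) (Fin n) ℝ) :
    sqDist T S = trace ((T - S)ᵀ * (T - S)) := by
  rw [sqDist_eq_sum, Finset.sum_comm, trace]
  refine Finset.sum_congr rfl fun i _ => ?_
  rw [diag_apply, mul_apply]
  refine Finset.sum_congr rfl fun j _ => ?_
  rw [transpose_apply, Matrix.sub_apply, pow_two]

theorem contDiff_sqDist (T : Matrix (Fin n) (Fin n) ℝ) : ContDiff ℝ ∞ (sqDist T) := by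
  have : sqDist T = fun S => ∑ i, ∑ j, (T i j - S i j) ^ 2 := funext (sqDist_eq_sum T)
  rw [this]
  refine ContDiff.sum fun i _ => ContDiff.sum fun j _ => (contDiff_const.sub ?_).pow 2
  exact (entryLinearMap ℝ ℝ i j).toContinuousLinearMap.contDiff

theorem fderiv_sqDist (T S v : Matrix (Fin n) (Fin n) ℝ) :
    fderiv ℝ (sqDist T) S v = -2 * trace ((T - S)ᵀ * v) := by
  have hline : HasDerivAt (fun t : ℝ => S + t • v) v 0 :=
    hasDerivAt_add_smul S v
  have hd : HasFDerivAt (sqDist T) (fderiv ℝ (sqDist T) S) (S + (0 : ℝ) • v) := by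
    rw [zero_smul, add_zero]
    exact ((contDiff_sqDist T).differentiable (by simp) S).hasFDerivAt
  have h1 := hd.comp_hasDerivAt (0 : ℝ) hline
  have hexp : sqDist T ∘ (fun t : ℝ => S + t • v) = fun t : ℝ =>
      trace ((T - S)ᵀ * (T - S)) + (t * (-2 * trace ((T - S)ᵀ * v)) + t ^ 2 * trace (vᵀ * v)) := by
    funext t
    have e1 : trace (vᵀ * (T - S)) = trace ((T - S)ᵀ * v) := by
      rw [← trace_transpose, transpose_mul, transpose_transpose]
    rw [Function.comp_apply, sqDist_eq_trace, ← sub_sub, transpose_sub,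
      sub_mul, mul_sub (T - S)ᵀ, mul_sub (t • v)ᵀ]
    simp only [transpose_smul, smul_mul_assoc, mul_smul_comm, trace_sub, trace_smul, smul_eq_mul, e1]
    ring
  rw [hexp] at h1
  have h2 : HasDerivAt (fun t : ℝ => trace ((T - S)ᵀ * (T - S)) +
      (t * (-2 * trace ((T - S)ᵀ * v)) + t ^ 2 * trace (vᵀ * v)))
      (-2 * trace ((T - S)ᵀ * v)) 0 := by
    simpa using (((hasDerivAt_id (0 : ℝ)).mul_const (-2 * trace ((T - S)ᵀ * v))).add
      ((hasDerivAt_pow 2 (0 : ℝ)).mul_const (trace (vᵀ * v)))).const_add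
        (trace ((T - S)ᵀ * (T - S)))
  exact h1.unique h2

/-- Second-order expansion of the squared distance at `P * T` along a curve of constant rank. -/
theorem tendsto_sqDist_curve {P T v : Matrix (Fin n) (Fin n) ℝ}
    {γ : ℝ → Matrix (Fin n) (Fin n) ℝ} (hP : P * P = P) (hPT : P * T = T * P) (hT : T.IsSymm)
    (hPs : P.IsSymm) (hN : IsUnit (pivot P (P * T))) (hγ0 : γ 0 = P * T) (hγ : HasDerivAt γ v 0)
    (hrank : ∀ᶠ t in 𝓝 0, (γ t).rank = P.rank) (hsymm : ∀ᶠ t in 𝓝 0, (γ t).IsSymm) :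
    Tendsto (fun t : ℝ => (sqDist T (γ t) - sqDist T (P * T)) / t ^ 2) (𝓝[≠] 0)
      (𝓝 (trace (v * v) -
        2 * trace (T * ((1 - P) * v * P * (pivot P (P * T))⁻¹ * (P * v * (1 - P)))))) := by
  have hPS : P * (P * T) = P * T := by rw [← mul_assoc, hP]
  have hSP : P * T * P = P * T := by rw [mul_assoc, ← hPT, hPS]
  have hcont : Continuous (trace : Matrix (Fin n) (Fin n) ℝ → ℝ) :=
    continuous_id.matrix_trace
  have hslope := hasDerivAt_iff_tendsto_slope.mp hγ
  have h1 := (hcont.tendsto _).comp (hslope.mul hslope)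
  have h2 := (hcont.tendsto _).comp
    ((tendsto_smul_schurTerm hP hPS hSP hN hγ0 hγ hrank).const_mul T)
  refine (h1.sub (h2.const_mul 2)).congr' ?_
  filter_upwards [self_mem_nhdsWithin, nhdsWithin_le_nhds hsymm] with t ht hs
  have ht : t ≠ 0 := ht
  -- With δ the difference quotient, γ t = PT + tδ holds exactly, so the expansion is an identity
  -- with no remainder to estimate.
  obtain ⟨δ, hδ⟩ : ∃ δ, δ = slope γ 0 t := ⟨_, rfl⟩
  have hγt : γ t = P * T + t • δ := by
    rw [hδ, slope_def_module, hγ0, sub_zero, smul_inv_smul₀ ht]; abel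
  have hSs : (P * T).IsSymm := by rw [IsSymm, transpose_mul, hT.eq, hPs.eq, hPT]
  have hδs : δᵀ = δ := by
    rw [hδ, slope_def_module, hγ0, transpose_smul, transpose_sub, hs.eq, hSs.eq]
  have hQγ : (1 - P) * γ t = t • ((1 - P) * δ) := by
    rw [hγt, mul_add, sub_mul 1 P (P * T), hPS, one_mul, sub_self, zero_add, mul_smul_comm]
  -- Since T - PT = QTQ, the apparently first-order term ⟨T - PT, δ⟩ sees only QδQ, which is t⁻¹ QγQ
  -- and hence itself of order t.
  have e1 : trace (T * ((1 - P) * δ * (1 - P))) = trace ((T - P * T) * δ) := by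
    have hQT : (1 - P) * T * (1 - P) = T - P * T := by
      rw [mul_sub, sub_mul 1 P T, one_mul, mul_one, sub_mul T, hSP, hPT, sub_self, sub_zero]
    rw [← mul_assoc, trace_mul_comm, ← mul_assoc, ← mul_assoc, hQT]
  have e2 : trace (δ * (T - P * T)) = trace ((T - P * T) * δ) := trace_mul_comm _ _
  simp only [Function.comp_apply, ← hδ]
  rw [hQγ, smul_mul_assoc, smul_smul, mul_smul_comm, trace_smul, e1, sqDist_eq_trace,
    sqDist_eq_trace, hγt, ← sub_sub, transpose_sub, transpose_sub T, hT.eq, hSs.eq, transpose_smul,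
    hδs, mul_sub, sub_mul (T - P * T), sub_mul (T - P * T)]
  simp only [smul_mul_assoc, mul_smul_comm, trace_sub, trace_smul, smul_eq_mul, e2]
  field_simp
  ring

/-! ### Local parameterizations -/

section LocalParam

variable {E : Type*} [NormedAddCommGroup E] [NormedSpace ℝ E] {X : Set E} {s : E} {d : ℕ}
  {U : Set (EuclideanSpace ℝ (Fin d))} {p : EuclideanSpace ℝ (Fin d) → E}

theorem IsLocalParam.contDiffAt (h : IsLocalParam X s U p) : ContDiffAt ℝ ∞ p 0 :=
  h.smooth.contDiffAt (h.isOpen.mem_nhds h.zero_mem)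

theorem IsLocalParam.hasDerivAt_line (h : IsLocalParam X s U p)
    (v : EuclideanSpace ℝ (Fin d)) : HasDerivAt (fun t : ℝ => p (t • v)) (fderiv ℝ p 0 v) 0 := by
  have hline : HasDerivAt (fun t : ℝ => t • v) v 0 := by
    simpa using (hasDerivAt_id (0 : ℝ)).smul_const v
  have h0 : HasFDerivAt p (fderiv ℝ p 0) ((0 : ℝ) • v) := by
    simpa using (h.contDiffAt.differentiableAt (by simp)).hasFDerivAt
  exact h0.comp_hasDerivAt (0 : ℝ) hline

theorem IsLocalParam.eventually_mem_line (h : IsLocalParam X s U p)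
    (v : EuclideanSpace ℝ (Fin d)) : ∀ᶠ t : ℝ in 𝓝 0, p (t • v) ∈ X := by
  obtain ⟨V, q, -, himg, -, -⟩ := h.exists_inverse
  have hcont : Tendsto (fun t : ℝ => t • v) (𝓝 0) (𝓝 0) := by
    have : Continuous fun t : ℝ => t • v := by fun_prop
    simpa using this.tendsto 0
  filter_upwards [hcont.eventually (h.isOpen.mem_nhds h.zero_mem)] with t ht
  exact (himg.subset (Set.mem_image_of_mem p ht)).1

/-- The derivative of a local parameterization has a linear right inverse on tangent vectors. -/
theorem IsLocalParam.exists_rightInverse (h : IsLocalParam X s U p) :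
    ∃ B : E →L[ℝ] EuclideanSpace ℝ (Fin d), ∀ v ∈ tangentVectors X s, fderiv ℝ p 0 (B v) = v := by
  obtain ⟨V, q, hV, himg, hq, hqp⟩ := h.exists_inverse
  have hsV : s ∈ V := by
    rw [← h.map_zero]
    exact (himg.subset (Set.mem_image_of_mem p h.zero_mem)).2
  have hqs : q s = 0 := by rw [← h.map_zero, hqp 0 h.zero_mem]
  refine ⟨fderiv ℝ q s, ?_⟩
  rintro v ⟨ε, γ, hε, -, hmem, hγ0, hγ⟩
  have hq1 : HasFDerivAt q (fderiv ℝ q s) (γ 0) := by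
    rw [hγ0]
    exact ((hq.contDiffAt (hV.mem_nhds hsV)).differentiableAt (by simp)).hasFDerivAt
  have hp1 : HasFDerivAt p (fderiv ℝ p 0) ((q ∘ γ) 0) := by
    rw [Function.comp_apply, hγ0, hqs]
    exact (h.contDiffAt.differentiableAt (by simp)).hasFDerivAt
  have h1 := hp1.comp_hasDerivAt (0 : ℝ) (hq1.comp_hasDerivAt (0 : ℝ) hγ)
  -- A curve in X near s factors through the parameterization, so the chain rule expresses its
  -- velocity as dp(dq v).
  have hev : γ =ᶠ[𝓝 0] p ∘ (q ∘ γ) := by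
    have hγV : ∀ᶠ t in 𝓝 0, γ t ∈ V :=
      hγ.continuousAt.eventually (by rw [hγ0]; exact hV.mem_nhds hsV)
    filter_upwards [hγV, Ioo_mem_nhds (neg_lt_zero.mpr hε) hε] with t htV ht
    obtain ⟨u, hu, hut⟩ := himg.superset ⟨hmem t ht, htV⟩
    simp only [Function.comp_apply]
    rw [← hut, hqp u hu]
  exact (h1.congr_of_eventuallyEq hev).unique hγ

end LocalParam

/-! ### Existence of a local parameterization -/

/-- The tangent space at a matrix with support idempotent `P`. -/
def tangentModel (P : Matrix (Fin n) (Fin n) ℝ) : Submodule ℝ (Matrix (Fin n) (Fin n) ℝ) where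
  carrier := {V | Vᵀ = V ∧ (1 - P) * V * (1 - P) = 0}
  add_mem' := by
    rintro V W ⟨h1, h2⟩ ⟨h3, h4⟩
    exact ⟨by rw [transpose_add, h1, h3], by rw [mul_add, add_mul, h2, h4, add_zero]⟩
  zero_mem' := by simp
  smul_mem' := by
    rintro c V ⟨h1, h2⟩
    exact ⟨by rw [transpose_smul, h1], by rw [mul_smul_comm, smul_mul_assoc, h2, smul_zero]⟩

theorem one_sub_mul_one_sub {P : Matrix (Fin n) (Fin n) ℝ} (hP : P * P = P) :
    (1 - P) * (1 - P) = 1 - P := by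
  rw [mul_sub, mul_one, sub_mul, hP, one_mul, sub_self, sub_zero]

/-- A linear projection onto `tangentModel P`. -/
noncomputable def tangentProj (P : Matrix (Fin n) (Fin n) ℝ) (hP : P * P = P) (hPs : Pᵀ = P) :
    Matrix (Fin n) (Fin n) ℝ →ₗ[ℝ] tangentModel P where
  toFun Y := ⟨(1 / 2 : ℝ) • (Y + Yᵀ) - (1 - P) * ((1 / 2 : ℝ) • (Y + Yᵀ)) * (1 - P), by
    constructor
    · simp [transpose_mul, hPs, add_comm, mul_assoc]
    · have hQ := one_sub_mul_one_sub hP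
      generalize 1 - P = Q at hQ ⊢
      rw [mul_sub, sub_mul, ← mul_assoc, ← mul_assoc, hQ, mul_assoc _ Q Q, hQ, sub_self]⟩
  map_add' Y Z := by
    ext1
    simp only [transpose_add, Submodule.coe_add]
    simp only [smul_add, mul_add, add_mul]
    abel
  map_smul' c Y := by
    ext1
    simp only [transpose_smul, Submodule.coe_smul, RingHom.id_apply, ← smul_add, smul_sub,
      mul_smul_comm, smul_mul_assoc, smul_comm c]

theorem tangentProj_apply_coe {P : Matrix (Fin n) (Fin n) ℝ} (hP : P * P = P) (hPs : Pᵀ = P)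
    (V : tangentModel P) : tangentProj P hP hPs V = V := by
  ext1
  have h1 : (1 / 2 : ℝ) • ((V : Matrix (Fin n) (Fin n) ℝ) + (V : Matrix (Fin n) (Fin n) ℝ)ᵀ) = V := by
    rw [V.2.1, ← two_smul ℝ, smul_smul]; norm_num
  change _ - _ = _
  rw [h1, V.2.2, sub_zero]

/-- The Schur correction lives in the QQ block. Because the projection kills it, the projection
inverts the graph parameterization. -/
theorem tangentProj_compress {P : Matrix (Fin n) (Fin n) ℝ} (hP : P * P = P) (hPs : Pᵀ = P)
    {C : Matrix (Fin n) (Fin n) ℝ} (hC : (1 - P) * C * (1 - P) = C) :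
    tangentProj P hP hPs C = 0 := by
  ext1
  have h1 : (1 - P) * Cᵀ * (1 - P) = Cᵀ := by
    conv_rhs => rw [← hC]
    simp [transpose_mul, hPs, mul_assoc]
  change _ - _ = _
  rw [mul_smul_comm, smul_mul_assoc, mul_add, add_mul, hC, h1, sub_self]
  rfl

theorem tangentProj_of_isSymm {P : Matrix (Fin n) (Fin n) ℝ} (hP : P * P = P) (hPs : Pᵀ = P)
    {Y : Matrix (Fin n) (Fin n) ℝ} (hY : Yᵀ = Y) :
    (tangentProj P hP hPs Y : Matrix (Fin n) (Fin n) ℝ) = Y - (1 - P) * Y * (1 - P) := by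
  change _ - _ = _
  have h1 : (1 / 2 : ℝ) • (Y + Yᵀ) = Y := by
    rw [hY, ← two_smul ℝ, smul_smul]; norm_num
  rw [h1]

/-- The pivot, like the Schur term below, does not involve the QQ block, so changing that block
leaves it unchanged. -/
theorem pivot_add_compress {P Z C : Matrix (Fin n) (Fin n) ℝ} (hP : P * P = P)
    (hC : (1 - P) * C * (1 - P) = C) : pivot P (Z + C) = pivot P Z := by
  have h1 : P * C = 0 := by
    rw [← hC, mul_assoc, ← mul_assoc, mul_sub, hP, mul_one, sub_self, zero_mul]
  rw [pivot, pivot, mul_add, h1, add_zero]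

theorem schurTerm_add_compress {P Z C : Matrix (Fin n) (Fin n) ℝ} (hP : P * P = P)
    (hC : (1 - P) * C * (1 - P) = C) : schurTerm P (Z + C) = schurTerm P Z := by
  have h1 : P * C = 0 := by
    rw [← hC, mul_assoc, ← mul_assoc, mul_sub, hP, mul_one, sub_self, zero_mul]
  have h2 : C * P = 0 := by
    rw [← hC, mul_assoc, sub_mul 1 P P, hP, one_mul, sub_self, mul_zero]
  rw [schurTerm, schurTerm, pivot_add_compress hP hC, mul_add P, h1, add_zero,
    mul_assoc (1 - P) (Z + C), add_mul, h2, add_zero, ← mul_assoc (1 - P) Z]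

theorem compress_schurTerm {P : Matrix (Fin n) (Fin n) ℝ} (hP : P * P = P)
    (Z : Matrix (Fin n) (Fin n) ℝ) : (1 - P) * schurTerm P Z * (1 - P) = schurTerm P Z := by
  have hQ := one_sub_mul_one_sub hP
  simp only [schurTerm, mul_assoc, hQ]
  rw [← mul_assoc, hQ]

theorem transpose_pivot {P Z : Matrix (Fin n) (Fin n) ℝ} (hPs : Pᵀ = P) :
    (pivot P Z)ᵀ = pivot P Zᵀ := by
  simp [pivot, transpose_mul, hPs, mul_assoc]

theorem transpose_schurTerm {P Z : Matrix (Fin n) (Fin n) ℝ} (hPs : Pᵀ = P)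
    (hZ : Zᵀ = Z) : (schurTerm P Z)ᵀ = schurTerm P Z := by
  simp only [schurTerm, transpose_mul, transpose_sub, transpose_one, hPs, hZ,
    transpose_nonsing_inv, transpose_pivot hPs, mul_assoc]

theorem contDiffOn_schurTerm (P : Matrix (Fin n) (Fin n) ℝ) :
    ContDiffOn ℝ ∞ (schurTerm P) {Z | IsUnit (pivot P Z)} := by
  intro Z hZ
  obtain ⟨u, hu⟩ : IsUnit (pivot P Z) := hZ
  have hpiv : ContDiff ℝ ∞ (pivot P) :=
    ((contDiff_const.mul contDiff_id).mul contDiff_const).add contDiff_const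
  have hinv : ContDiffAt ℝ ∞ (fun Z => (pivot P Z)⁻¹) Z := by
    simp only [nonsing_inv_eq_ringInverse]
    have h1 := contDiffAt_ringInverse (n := ∞) ℝ u
    rw [hu] at h1
    exact h1.comp Z hpiv.contDiffAt
  have h2 : ContDiffAt ℝ ∞ (fun Z => (1 - P) * Z * P) Z :=
    (contDiffAt_const.mul contDiffAt_id).mul contDiffAt_const
  have h3 : ContDiffAt ℝ ∞ (fun Z => P * Z * (1 - P)) Z :=
    (contDiffAt_const.mul contDiffAt_id).mul contDiffAt_const
  exact ((h2.mul hinv).mul h3).contDiffWithinAt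

theorem isOpen_isUnit_pivot (P : Matrix (Fin n) (Fin n) ℝ) :
    IsOpen {Z | IsUnit (pivot P Z)} := by
  have hpiv : Continuous (pivot P) :=
    ((continuous_const.mul continuous_id).mul continuous_const).add continuous_const
  exact Units.isOpen.preimage hpiv

/-- The chart is the graph map V ↦ S + V + `schurTerm P (S + V)` over the tangent space: the added
term is the only QQ block compatible with the rank. Its inverse is the linear projection Z ↦
`tangentProj` (Z - S). -/
theorem exists_isLocalParam {r : ℕ} {P S : Matrix (Fin n) (Fin n) ℝ} (hP : P * P = P)
    (hPs : Pᵀ = P) (hrank : P.rank = r) (hSs : Sᵀ = S) (hPS : P * S = S) (hSP : S * P = S)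
    (hN : IsUnit (pivot P S)) :
    ∃ (d : ℕ) (U : Set (EuclideanSpace ℝ (Fin d)))
      (p : EuclideanSpace ℝ (Fin d) → Matrix (Fin n) (Fin n) ℝ),
      IsLocalParam (symRank r n) S U p := by
  have e : EuclideanSpace ℝ (Fin (Module.finrank ℝ (tangentModel P))) ≃L[ℝ] tangentModel P :=
    ContinuousLinearEquiv.ofFinrankEq (by simp)
  have hQS : (1 - P) * S = 0 := by rw [sub_mul, hPS, one_mul, sub_self]
  have hSQ : S * (1 - P) = 0 := by rw [mul_sub, hSP, mul_one, sub_self]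
  let z : EuclideanSpace ℝ (Fin (Module.finrank ℝ (tangentModel P))) →
    Matrix (Fin n) (Fin n) ℝ := fun u => S + e u
  have hz : ContDiff ℝ ∞ z :=
    contDiff_const.add ((tangentModel P).subtypeL.contDiff.comp e.contDiff)
  have hzs : ∀ u, (z u)ᵀ = z u := fun u => by
    simp only [z, transpose_add, hSs, (e u).2.1]
  have hzQ : ∀ u, (1 - P) * z u * (1 - P) = 0 := fun u => by
    simp only [z, mul_add, add_mul, hQS, (e u).2.2, zero_mul, add_zero]
  have hC : ∀ u, (1 - P) * schurTerm P (z u) * (1 - P) = schurTerm P (z u) := fun u =>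
    compress_schurTerm hP _
  let τ := tangentProj P hP hPs
  refine ⟨_, {u | IsUnit (pivot P (z u))}, fun u => z u + schurTerm P (z u), ?_, ?_, ?_, ?_,
    {Z | IsUnit (pivot P Z)}, fun Z => e.symm (τ (Z - S)), isOpen_isUnit_pivot P, ?_, ?_, ?_⟩
  · exact (isOpen_isUnit_pivot P).preimage hz.continuous
  · simpa [z] using hN
  · have : P * S * (1 - P) = 0 := by rw [mul_assoc, hSQ, mul_zero]
    simp [z, schurTerm, hQS]
  · exact hz.contDiffOn.add ((contDiffOn_schurTerm P).comp hz.contDiffOn fun u hu => hu)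
  · ext Z
    constructor
    · rintro ⟨u, hu, rfl⟩
      have hu : IsUnit (pivot P (z u)) := hu
      have hpu : IsUnit (pivot P (z u + schurTerm P (z u))) := by
        rwa [pivot_add_compress hP (hC u)]
      refine ⟨⟨?_, ?_⟩, hpu⟩
      · rw [IsSymm, transpose_add, hzs, transpose_schurTerm hPs (hzs u)]
      · rw [← hrank, rank_eq_rank_iff hP hpu, schurTerm_add_compress hP (hC u), mul_add, add_mul,
          hzQ, hC, zero_add]
    · rintro ⟨⟨hZs, hZr⟩, hZ⟩
      have hZ : IsUnit (pivot P Z) := hZ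
      have hsch := (rank_eq_rank_iff hP hZ).mp (hZr.trans hrank.symm)
      -- Projecting removes the QQ block of Z, which by the rank condition is exactly its Schur
      -- term.
      have hzu : z (e.symm (τ (Z - S))) = Z + -schurTerm P Z := by
        have h1 : (Z - S)ᵀ = Z - S := by rw [transpose_sub, hZs.eq, hSs]
        have h2 := tangentProj_of_isSymm hP hPs h1
        simp only [z, ContinuousLinearEquiv.apply_symm_apply, τ]
        rw [h2, mul_sub (1 - P) Z, hQS, sub_zero, hsch]
        abel
      have hC' : (1 - P) * (-schurTerm P Z) * (1 - P) = -schurTerm P Z := by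
        rw [mul_neg, neg_mul, compress_schurTerm hP]
      refine ⟨e.symm (τ (Z - S)), ?_, ?_⟩
      · rw [Set.mem_ofPred_eq, hzu, pivot_add_compress hP hC']
        exact hZ
      · simp only [hzu, schurTerm_add_compress hP hC']
        abel
  · have h1 : ContDiff ℝ ∞ fun Z : Matrix (Fin n) (Fin n) ℝ => τ (Z - S) :=
      τ.toContinuousLinearMap.contDiff.comp (contDiff_id.sub contDiff_const)
    exact (e.symm.contDiff.comp h1).contDiffOn
  · intro u _
    have h1 : z u + schurTerm P (z u) - S = (e u : Matrix (Fin n) (Fin n) ℝ) + schurTerm P (z u) := by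
      simp only [z]; abel
    simp only [h1, map_add, τ, tangentProj_apply_coe, tangentProj_compress hP hPs (hC u)]
    simp

end ConstantRank

section SquaredDistance

variable {n : ℕ}

/-! ### Spectral coordinates -/

section Spectral

variable {U : Matrix (Fin n) (Fin n) ℝ} {σ : Fin n → ℝ} {I : Finset (Fin n)}

theorem conj_mul_conj (hU : Uᵀ * U = 1) (A B : Matrix (Fin n) (Fin n) ℝ) :
    U * A * Uᵀ * (U * B * Uᵀ) = U * (A * B) * Uᵀ := by
  rw [mul_assoc (U * A), ← mul_assoc Uᵀ, ← mul_assoc Uᵀ, hU, one_mul]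
  simp only [mul_assoc]

theorem trace_conj (hU : Uᵀ * U = 1) (A : Matrix (Fin n) (Fin n) ℝ) :
    trace (U * A * Uᵀ) = trace A := by
  rw [trace_mul_comm, ← mul_assoc, hU, one_mul]

theorem isUnit_det_of_orthogonal (hU : Uᵀ * U = 1) : IsUnit U.det ∧ IsUnit Uᵀ.det :=
  ⟨isUnit_det_of_left_inverse hU, isUnit_det_of_right_inverse hU⟩

theorem rank_conj (hU : Uᵀ * U = 1) (A : Matrix (Fin n) (Fin n) ℝ) :
    (U * A * Uᵀ).rank = A.rank := by
  rw [rank_mul_eq_left_of_isUnit_det _ _ (isUnit_det_of_orthogonal hU).2,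
    rank_mul_eq_right_of_isUnit_det _ _ (isUnit_det_of_orthogonal hU).1]

theorem transpose_conj (A : Matrix (Fin n) (Fin n) ℝ) : (U * A * Uᵀ)ᵀ = U * Aᵀ * Uᵀ := by
  simp only [transpose_mul, transpose_transpose, mul_assoc]

theorem conj_transpose_conj (hU : Uᵀ * U = 1) (A : Matrix (Fin n) (Fin n) ℝ) :
    U * (Uᵀ * A * U) * Uᵀ = A := by
  have hU' : U * Uᵀ = 1 := mul_eq_one_comm.mp hU
  rw [← mul_assoc, ← mul_assoc, hU', one_mul, mul_assoc, hU', mul_one]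

theorem transpose_conj_conj (hU : Uᵀ * U = 1) (A : Matrix (Fin n) (Fin n) ℝ) :
    Uᵀ * (U * A * Uᵀ) * U = A := by
  rw [← mul_assoc, ← mul_assoc, hU, one_mul, mul_assoc, hU, mul_one]

theorem rank_partialSum (hU : Uᵀ * U = 1) (hσ : ∀ i, σ i ≠ 0) :
    (partialSum U σ I).rank = I.card := by
  rw [partialSum, rank_conj hU, rank_diagonal]
  simp [hσ]

theorem transpose_partialSum : (partialSum U σ I)ᵀ = partialSum U σ I := by
  rw [partialSum, transpose_conj, diagonal_transpose]

theorem partialSum_mul_partialSum (hU : Uᵀ * U = 1) (τ : Fin n → ℝ) :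
    partialSum U σ I * partialSum U τ I = partialSum U (σ * τ) I := by
  rw [partialSum, partialSum, conj_mul_conj hU, diagonal_mul_diagonal, partialSum]
  congr 3
  ext i
  by_cases hi : i ∈ I <;> simp [hi]

/-- The orthogonal projection onto the span of the eigenvectors with index in `I`. -/
def spectralProj (U : Matrix (Fin n) (Fin n) ℝ) (I : Finset (Fin n)) :
    Matrix (Fin n) (Fin n) ℝ :=
  partialSum U 1 I

theorem spectralProj_mul_self (hU : Uᵀ * U = 1) :
    spectralProj U I * spectralProj U I = spectralProj U I := by
  rw [spectralProj, partialSum_mul_partialSum hU, one_mul]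

theorem spectralProj_mul_partialSum (hU : Uᵀ * U = 1) :
    spectralProj U I * partialSum U σ I = partialSum U σ I := by
  rw [spectralProj, partialSum_mul_partialSum hU, one_mul]

theorem partialSum_mul_spectralProj (hU : Uᵀ * U = 1) :
    partialSum U σ I * spectralProj U I = partialSum U σ I := by
  rw [spectralProj, partialSum_mul_partialSum hU, mul_one]

theorem spectralProj_mul (hU : Uᵀ * U = 1) :
    spectralProj U I * (U * diagonal σ * Uᵀ) = partialSum U σ I := by
  rw [spectralProj, partialSum, conj_mul_conj hU, diagonal_mul_diagonal, partialSum]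
  simp

theorem mul_spectralProj (hU : Uᵀ * U = 1) :
    U * diagonal σ * Uᵀ * spectralProj U I = partialSum U σ I := by
  rw [spectralProj, partialSum, conj_mul_conj hU, diagonal_mul_diagonal, partialSum]
  simp

theorem one_sub_spectralProj (hU : Uᵀ * U = 1) :
    1 - spectralProj U I = U * diagonal (fun i => if i ∈ I then 0 else 1) * Uᵀ := by
  have hU' : U * Uᵀ = 1 := mul_eq_one_comm.mp hU
  have h1 : diagonal (fun i => if i ∈ I then (0 : ℝ) else 1) =
      1 - diagonal (fun i => if i ∈ I then (1 : Fin n → ℝ) i else 0) := by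
    rw [← diagonal_one, diagonal_sub]
    congr 1
    ext i
    by_cases hi : i ∈ I <;> simp [hi]
  rw [h1, mul_sub, sub_mul, mul_one, hU', spectralProj, partialSum]

theorem pivot_partialSum (hU : Uᵀ * U = 1) :
    pivot (spectralProj U I) (partialSum U σ I) =
      U * diagonal (fun i => if i ∈ I then σ i else 1) * Uᵀ := by
  rw [pivot, spectralProj_mul_partialSum hU, partialSum_mul_spectralProj hU,
    one_sub_spectralProj hU, partialSum, ← add_mul, ← mul_add, diagonal_add]
  congr 3
  ext i
  by_cases hi : i ∈ I <;> simp [hi]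

theorem pivot_partialSum_mul (hU : Uᵀ * U = 1) (hσ : ∀ i, σ i ≠ 0) :
    pivot (spectralProj U I) (partialSum U σ I) *
      (U * diagonal (fun i => if i ∈ I then (σ i)⁻¹ else 1) * Uᵀ) = 1 := by
  have hU' : U * Uᵀ = 1 := mul_eq_one_comm.mp hU
  rw [pivot_partialSum hU, conj_mul_conj hU, diagonal_mul_diagonal]
  have : (fun i => (if i ∈ I then σ i else 1) * (if i ∈ I then (σ i)⁻¹ else 1)) =
      fun _ => (1 : ℝ) := by
    ext i
    by_cases hi : i ∈ I <;> simp [hi, hσ i]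
  rw [this, diagonal_one, mul_one, hU']

theorem isUnit_pivot_partialSum (hU : Uᵀ * U = 1) (hσ : ∀ i, σ i ≠ 0) :
    IsUnit (pivot (spectralProj U I) (partialSum U σ I)) := by
  rw [isUnit_iff_isUnit_det]
  exact isUnit_det_of_right_inverse (pivot_partialSum_mul hU hσ)

theorem inv_pivot_partialSum (hU : Uᵀ * U = 1) (hσ : ∀ i, σ i ≠ 0) :
    (pivot (spectralProj U I) (partialSum U σ I))⁻¹ =
      U * diagonal (fun i => if i ∈ I then (σ i)⁻¹ else 1) * Uᵀ :=
  inv_eq_right_inv (pivot_partialSum_mul hU hσ)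

theorem apply_eq_zero_of_compress (hU : Uᵀ * U = 1) {W : Matrix (Fin n) (Fin n) ℝ}
    (h : (1 - spectralProj U I) * (U * W * Uᵀ) * (1 - spectralProj U I) = 0) {i j : Fin n}
    (hi : i ∉ I) (hj : j ∉ I) : W i j = 0 := by
  rw [one_sub_spectralProj hU, conj_mul_conj hU, conj_mul_conj hU] at h
  have h1 := congrArg (fun A => (Uᵀ * A * U) i j) h
  simp only [transpose_conj_conj hU] at h1
  simpa [hi, hj] using h1

/-- The second-order form of the squared distance in spectral coordinates. -/
theorem hessianForm_eq_sum (hU : Uᵀ * U = 1) (hσ : ∀ i, σ i ≠ 0)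
    {W : Matrix (Fin n) (Fin n) ℝ} (hW : Wᵀ = W) (hW0 : ∀ i ∉ I, ∀ j ∉ I, W i j = 0) :
    trace (U * W * Uᵀ * (U * W * Uᵀ)) - 2 * trace (U * diagonal σ * Uᵀ *
      ((1 - spectralProj U I) * (U * W * Uᵀ) * spectralProj U I *
        (pivot (spectralProj U I) (partialSum U σ I))⁻¹ *
        (spectralProj U I * (U * W * Uᵀ) * (1 - spectralProj U I)))) =
    ∑ i, ∑ j, (if i ∈ I then if j ∈ I then 1 else 2 * (1 - σ j / σ i) else 0) * W i j ^ 2 := by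
  have hWs : ∀ i j, W j i = W i j := fun i j => congrFun₂ hW i j
  have h1 : trace (U * W * Uᵀ * (U * W * Uᵀ)) = ∑ i, ∑ j, W i j ^ 2 := by
    rw [conj_mul_conj hU, trace_conj hU, trace]
    refine Finset.sum_congr rfl fun i _ => ?_
    rw [diag_apply, mul_apply]
    refine Finset.sum_congr rfl fun j _ => ?_
    rw [hWs i j, pow_two]
  -- The trace runs over closed paths j → i → j with j ∉ I and i ∈ I, weighted by σ_j from T and by
  -- σ_i⁻¹ from the inverse pivot.
  have h2 : trace (U * diagonal σ * Uᵀ *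
      ((1 - spectralProj U I) * (U * W * Uᵀ) * spectralProj U I *
        (pivot (spectralProj U I) (partialSum U σ I))⁻¹ *
        (spectralProj U I * (U * W * Uᵀ) * (1 - spectralProj U I)))) =
      ∑ i, ∑ j, if i ∈ I then if j ∈ I then 0 else σ j / σ i * W i j ^ 2 else 0 := by
    rw [inv_pivot_partialSum hU hσ, one_sub_spectralProj hU, spectralProj, partialSum]
    simp only [conj_mul_conj hU, trace_conj hU]
    rw [Finset.sum_comm, trace]
    refine Finset.sum_congr rfl fun j _ => ?_
    rw [diag_apply, diagonal_mul, mul_apply, Finset.mul_sum]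
    refine Finset.sum_congr rfl fun i _ => ?_
    rw [mul_diagonal, mul_diagonal, diagonal_mul, mul_diagonal, diagonal_mul, hWs i j]
    by_cases hi : i ∈ I <;> by_cases hj : j ∈ I <;> simp [hi, hj]
    ring
  -- By symmetry the Iᶜ × I block is folded onto the I × Iᶜ block, which produces the factor 2; the
  -- Iᶜ × Iᶜ block vanishes.
  have h3 : ∑ i, ∑ j, W i j ^ 2 =
      (∑ i, ∑ j, if i ∈ I then if j ∈ I then W i j ^ 2 else W i j ^ 2 else 0) +
        ∑ i, ∑ j, if i ∈ I then if j ∈ I then 0 else W i j ^ 2 else 0 := by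
    conv_rhs => rhs; rw [Finset.sum_comm]
    simp only [← Finset.sum_add_distrib]
    refine Finset.sum_congr rfl fun i _ => Finset.sum_congr rfl fun j _ => ?_
    by_cases hi : i ∈ I <;> by_cases hj : j ∈ I <;> simp [hi, hj, hWs i j]
    simp [hW0 i hi j hj]
  rw [h1, h2, h3]
  simp only [Finset.mul_sum, ← Finset.sum_add_distrib, ← Finset.sum_sub_distrib]
  refine Finset.sum_congr rfl fun i _ => Finset.sum_congr rfl fun j _ => ?_
  by_cases hi : i ∈ I <;> by_cases hj : j ∈ I <;> simp [hi, hj]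
  ring

end Spectral

/-! ### Critical points of the squared distance -/

variable {U : Matrix (Fin n) (Fin n) ℝ} {σ : Fin n → ℝ}

theorem partialSum_mem_symRank (hU : Uᵀ * U = 1) (hσ : ∀ i, σ i ≠ 0) (I : Finset (Fin n)) :
    partialSum U σ I ∈ symRank I.card n :=
  ⟨transpose_partialSum, rank_partialSum hU hσ⟩

theorem rank_spectralProj (hU : Uᵀ * U = 1) (I : Finset (Fin n)) :
    (spectralProj U I).rank = I.card :=
  rank_partialSum hU fun _ => one_ne_zero

/-- The residual T - S_I equals QTQ, and cyclicity of the trace turns ⟨QTQ, v⟩ into ⟨T, QvQ⟩, which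
is zero for tangent v. -/
theorem isCriticalPointOn_partialSum (hU : Uᵀ * U = 1) (hσ : ∀ i, σ i ≠ 0)
    (I : Finset (Fin n)) :
    IsCriticalPointOn (sqDist (U * diagonal σ * Uᵀ)) (symRank I.card n) (partialSum U σ I) := by
  refine ⟨partialSum_mem_symRank hU hσ I, ?_⟩
  rintro v ⟨ε, γ, hε, -, hmem, hγ0, hγ⟩
  have hev : ∀ᶠ t in 𝓝 0, γ t ∈ symRank I.card n := by
    filter_upwards [Ioo_mem_nhds (neg_lt_zero.mpr hε) hε] with t ht using hmem t ht
  have hv := compl_mul_deriv_mul_compl (spectralProj_mul_self hU)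
    (spectralProj_mul_partialSum hU) (partialSum_mul_spectralProj hU)
    (isUnit_pivot_partialSum hU hσ) hγ0 hγ
    (hev.mono fun t ht => ht.2.trans (rank_spectralProj hU I).symm)
  have hR : (1 - spectralProj U I) * (U * diagonal σ * Uᵀ) * (1 - spectralProj U I) =
      U * diagonal σ * Uᵀ - partialSum U σ I := by
    rw [sub_mul 1, one_mul, spectralProj_mul hU, mul_sub, mul_one, sub_mul, mul_spectralProj hU,
      partialSum_mul_spectralProj hU, sub_self, sub_zero]
  have hRt : (U * diagonal σ * Uᵀ - partialSum U σ I)ᵀ = U * diagonal σ * Uᵀ - partialSum U σ I := by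
    rw [transpose_sub, transpose_conj, diagonal_transpose, transpose_partialSum]
  refine (fderiv_sqDist _ _ _).trans ?_
  rw [hRt, ← hR, mul_assoc, mul_assoc, trace_mul_comm, mul_assoc, hv, mul_zero,
    trace_zero, mul_zero]

theorem exists_eq_partialSum_of_isCriticalPointOn {r : ℕ} (hU : Uᵀ * U = 1) (hσ : ∀ i, σ i ≠ 0)
    (hinj : Function.Injective σ) {S : Matrix (Fin n) (Fin n) ℝ}
    (hS : IsCriticalPointOn (sqDist (U * diagonal σ * Uᵀ)) (symRank r n) S) :
    ∃ I : Finset (Fin n), I.card = r ∧ S = partialSum U σ I := by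
  obtain ⟨hmem, hcrit⟩ := hS
  have hSs : Sᵀ = S := hmem.1
  obtain ⟨T, hT⟩ : ∃ T, T = U * diagonal σ * Uᵀ := ⟨_, rfl⟩
  have hTs : Tᵀ = T := by rw [hT, transpose_conj, diagonal_transpose]
  rw [← hT] at hcrit
  have hRs : (T - S)ᵀ = T - S := by rw [transpose_sub, hTs, hSs]
  have h0 : S * (T - S) = 0 := by
    -- The choice X = (S(T - S))ᵀ makes the derivative equal to -4‖S(T - S)‖².
    have h1 := hcrit _ (mul_add_mul_transpose_mem_tangentVectors hmem (S * (T - S))ᵀ)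
    replace h1 := (fderiv_sqDist _ _ _).symm.trans h1
    rw [hRs, transpose_transpose, mul_add, trace_add] at h1
    have e1 : trace ((T - S) * ((S * (T - S))ᵀ * S)) = trace ((S * (T - S)) * (S * (T - S))ᵀ) := by
      rw [← mul_assoc, trace_mul_comm, ← mul_assoc]
    have e2 : trace ((T - S) * (S * (S * (T - S)))) = trace ((S * (T - S)) * (S * (T - S))ᵀ) := by
      rw [← trace_transpose, transpose_mul, transpose_mul, hRs, hSs, mul_assoc, trace_mul_comm,
        trace_mul_comm (S * (T - S))]
    rw [e1, e2] at h1
    rw [← trace_mul_conjTranspose_self_eq_zero_iff, conjTranspose_eq_transpose_of_trivial]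
    linarith
  have hST : S * T = S * S := by rwa [mul_sub, sub_eq_zero] at h0
  have hTS : T * S = S * S := by
    have := congrArg transpose hST
    rwa [transpose_mul, transpose_mul, hTs, hSs] at this
  obtain ⟨D, hD⟩ : ∃ D, D = Uᵀ * S * U := ⟨_, rfl⟩
  have hSD : S = U * D * Uᵀ := by rw [hD, conj_transpose_conj hU]
  have hcancel : ∀ A B : Matrix (Fin n) (Fin n) ℝ, U * A * Uᵀ = U * B * Uᵀ → A = B := by
    intro A B h
    rw [← transpose_conj_conj hU A, h, transpose_conj_conj hU]
  have hDσ : D * diagonal σ = D * D := by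
    rw [hSD, hT, conj_mul_conj hU, conj_mul_conj hU] at hST
    exact hcancel _ _ hST
  have hσD : diagonal σ * D = D * D := by
    rw [hSD, hT, conj_mul_conj hU, conj_mul_conj hU] at hTS
    exact hcancel _ _ hTS
  -- A matrix commuting with a diagonal matrix of distinct entries is diagonal.
  have hoff : ∀ i j, i ≠ j → D i j = 0 := by
    intro i j hij
    have h1 := congrFun₂ (hDσ.trans hσD.symm) i j
    rw [mul_diagonal, diagonal_mul, mul_comm] at h1
    by_contra hne
    exact hij (hinj (mul_right_cancel₀ hne h1)).symm
  have hDd : D = diagonal fun i => D i i := by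
    ext i j
    by_cases hij : i = j
    · subst hij; simp
    · rw [hoff i j hij, diagonal_apply_ne _ hij]
  have hdiag : ∀ i, D i i * σ i = D i i * D i i := by
    intro i
    have h1 := congrFun₂ hDσ i i
    rw [mul_diagonal] at h1
    rw [h1]
    conv_lhs => rw [hDd]
    rw [diagonal_mul_diagonal, diagonal_apply_eq]
  -- From d_i σ_i = d_i², every diagonal entry is 0 or σ_i; the index set is the support.
  have hSI : S = partialSum U σ {i | D i i ≠ 0} := by
    rw [hSD, partialSum]
    congr 2
    conv_lhs => rw [hDd]
    congr 1
    ext i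
    by_cases hi : D i i = 0
    · simp [hi]
    · simpa [hi] using (mul_left_cancel₀ hi (hdiag i)).symm
  refine ⟨_, ?_, hSI⟩
  rw [← rank_partialSum hU hσ, ← hSI, hmem.2]

theorem partialSum_injective (hU : Uᵀ * U = 1) (hσ : ∀ i, σ i ≠ 0) :
    Function.Injective (partialSum U σ) := by
  intro I J h
  have h1 := congrArg (fun A => Uᵀ * A * U) h
  simp only [partialSum, transpose_conj_conj hU] at h1
  ext i
  have h2 := congrFun (diagonal_injective h1) i
  by_cases hi : i ∈ I <;> by_cases hj : i ∈ J <;> simp [hi, hj, hσ i, (hσ i).symm] at h2 ⊢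

/-- The index set in the index formula. -/
theorem mem_filter_ratio_iff (hσ : ∀ i, σ i ≠ 0) (hinj : Function.Injective σ)
    {I : Finset (Fin n)} {i j : Fin n} :
    (i, j) ∈ (I ×ˢ Iᶜ).filter (fun p => 0 ≤ σ p.1 / σ p.2 ∧ σ p.1 / σ p.2 ≤ 1) ↔
      i ∈ I ∧ j ∉ I ∧ 1 - σ j / σ i < 0 := by
  rw [Finset.mem_filter, Finset.mem_product, Finset.mem_compl, and_assoc]
  refine and_congr_right fun hi => and_congr_right fun hj => ?_
  -- Distinct, nonzero eigenvalues exclude the ratios 1 and 0, so the weak inequalities are strict.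
  have hne : σ i / σ j ≠ 1 := by
    rw [Ne, div_eq_one_iff_eq (hσ j)]
    exact fun h => hj (hinj h ▸ hi)
  have hne0 : σ i / σ j ≠ 0 := div_ne_zero (hσ i) (hσ j)
  change 0 ≤ σ i / σ j ∧ σ i / σ j ≤ 1 ↔ _
  rw [sub_neg, ← inv_div (σ i), one_lt_inv_iff₀]
  exact ⟨fun h => ⟨h.1.lt_of_ne' hne0, h.2.lt_of_ne hne⟩, fun h => ⟨h.1.le, h.2.le⟩⟩

/-! ### The Morse index -/

/-- Places `x` in the transposed positions of the index set `D`. -/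
def scatter (D : Finset (Fin n × Fin n)) : (D → ℝ) →ₗ[ℝ] Matrix (Fin n) (Fin n) ℝ where
  toFun x := of fun j i => if h : (i, j) ∈ D then x ⟨(i, j), h⟩ else 0
  map_add' x y := by
    ext j i
    by_cases h : (i, j) ∈ D <;> simp [h]
  map_smul' c x := by
    ext j i
    by_cases h : (i, j) ∈ D <;> simp [h]

theorem scatter_apply_of_mem {D : Finset (Fin n × Fin n)} (x : D → ℝ) {i j : Fin n}
    (h : (i, j) ∈ D) : scatter D x j i = x ⟨(i, j), h⟩ :=
  dif_pos h

theorem scatter_apply_of_notMem {D : Finset (Fin n × Fin n)} (x : D → ℝ) {i j : Fin n}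
    (h : (i, j) ∉ D) : scatter D x j i = 0 :=
  dif_neg h

/-- Symmetrized scattered matrices in spectral coordinates. -/
noncomputable def symmScatter (U : Matrix (Fin n) (Fin n) ℝ) (D : Finset (Fin n × Fin n)) :
    (D → ℝ) →ₗ[ℝ] Matrix (Fin n) (Fin n) ℝ where
  toFun x := U * (scatter D x + (scatter D x)ᵀ) * Uᵀ
  map_add' x y := by
    rw [map_add, transpose_add, ← add_mul, ← mul_add]
    congr 2
    abel
  map_smul' c x := by
    rw [map_smul, transpose_smul, ← smul_add, mul_smul_comm, smul_mul_assoc, RingHom.id_apply]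

/-- The scattered matrix has all its nonzero columns indexed by I, so dividing column i by σ_i
writes it as a product XS in spectral coordinates. This is why the positions are transposed. -/
theorem symmScatter_mem_tangentVectors (hU : Uᵀ * U = 1) (hσ : ∀ i, σ i ≠ 0)
    {I : Finset (Fin n)} {D : Finset (Fin n × Fin n)} (hD : ∀ i j, (i, j) ∈ D → i ∈ I)
    (x : D → ℝ) :
    symmScatter U D x ∈ tangentVectors (symRank I.card n) (partialSum U σ I) := by
  have h1 : U * (scatter D x * diagonal fun i => (σ i)⁻¹) * Uᵀ * partialSum U σ I =
      U * scatter D x * Uᵀ := by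
    rw [partialSum, conj_mul_conj hU, mul_assoc (scatter D x), diagonal_mul_diagonal]
    congr 2
    ext j i
    rw [mul_diagonal]
    by_cases hi : i ∈ I
    · simp [hi, hσ i]
    · simp [scatter_apply_of_notMem x fun h => hi (hD i j h)]
  have h2 := mul_add_mul_transpose_mem_tangentVectors (partialSum_mem_symRank hU hσ I)
    (U * (scatter D x * diagonal fun i => (σ i)⁻¹) * Uᵀ)
  have h3 := congrArg transpose h1
  rw [transpose_mul, transpose_partialSum, transpose_conj (scatter D x)] at h3
  rw [h1, h3, ← add_mul, ← mul_add] at h2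
  exact h2

/-- Inertia is applied with D the set of pairs of negative coefficient. Only a right inverse of dp
on tangent vectors is needed, not the dimension of the chart. -/
theorem numNegEigenvalues_hessianMatrix (hU : Uᵀ * U = 1) (hσ : ∀ i, σ i ≠ 0)
    (hinj : Function.Injective σ) {I : Finset (Fin n)} {d : ℕ}
    {O : Set (EuclideanSpace ℝ (Fin d))} {p : EuclideanSpace ℝ (Fin d) → Matrix (Fin n) (Fin n) ℝ}
    (h : IsLocalParam (symRank I.card n) (partialSum U σ I) O p) :
    numNegEigenvalues (hessianMatrix (sqDist (U * diagonal σ * Uᵀ) ∘ p) 0) =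
      ((I ×ˢ Iᶜ).filter fun p => 0 ≤ σ p.1 / σ p.2 ∧ σ p.1 / σ p.2 ≤ 1).card := by
  set D := (I ×ˢ Iᶜ).filter fun p => 0 ≤ σ p.1 / σ p.2 ∧ σ p.1 / σ p.2 ≤ 1 with hDdef
  have hD : ∀ i j, (i, j) ∈ D ↔ i ∈ I ∧ j ∉ I ∧ 1 - σ j / σ i < 0 := fun i j =>
    mem_filter_ratio_iff hσ hinj
  have hP := spectralProj_mul_self (I := I) hU
  have hS : spectralProj U I * (U * diagonal σ * Uᵀ) = partialSum U σ I := spectralProj_mul hU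
  have hf : ContDiffAt ℝ 2 (sqDist (U * diagonal σ * Uᵀ) ∘ p) 0 :=
    ((contDiff_sqDist _).contDiffAt.comp 0 h.contDiffAt).of_le (by norm_cast)
  obtain ⟨B, hB⟩ := h.exists_rightInverse
  let A := fderiv ℝ p 0
  let c : Fin n → Fin n → ℝ := fun i j =>
    if i ∈ I then if j ∈ I then 1 else 2 * (1 - σ j / σ i) else 0
  have hq : ∀ v : EuclideanSpace ℝ (Fin d),
      v.ofLp ⬝ᵥ hessianMatrix (sqDist (U * diagonal σ * Uᵀ) ∘ p) 0 *ᵥ v.ofLp =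
        2 * ∑ i, ∑ j, c i j * (Uᵀ * A v * U) i j ^ 2 := by
    intro v
    have hγ := h.hasDerivAt_line v
    have hγ0 : p ((0 : ℝ) • v) = partialSum U σ I := by rw [zero_smul, h.map_zero]
    have hmem := h.eventually_mem_line v
    have hsymm : ∀ᶠ t : ℝ in 𝓝 0, (p (t • v)).IsSymm := hmem.mono fun t ht => ht.1
    have hrank : ∀ᶠ t : ℝ in 𝓝 0, (p (t • v)).rank = (spectralProj U I).rank :=
      hmem.mono fun t ht => ht.2.trans (rank_spectralProj hU I).symm
    have hAs : (A v)ᵀ = A v := isSymm_deriv hγ hsymm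
    have hAQ := compl_mul_deriv_mul_compl hP (spectralProj_mul_partialSum hU)
      (partialSum_mul_spectralProj hU) (isUnit_pivot_partialSum hU hσ) hγ0 hγ hrank
    have hlim := tendsto_sqDist_curve (T := U * diagonal σ * Uᵀ) hP
      (hS.trans (mul_spectralProj hU).symm) (by rw [IsSymm, transpose_conj, diagonal_transpose])
      transpose_partialSum (by rw [hS]; exact isUnit_pivot_partialSum hU hσ) (hγ0.trans hS.symm)
      hγ hrank hsymm
    obtain ⟨W, hW⟩ : ∃ W, W = Uᵀ * A v * U := ⟨_, rfl⟩
    have hAW : A v = U * W * Uᵀ := by rw [hW, conj_transpose_conj hU]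
    have hWs : Wᵀ = W := by
      rw [hW]; simp only [transpose_mul, transpose_transpose, hAs, mul_assoc]
    change (1 - spectralProj U I) * A v * (1 - spectralProj U I) = 0 at hAQ
    rw [hS] at hlim
    change Tendsto _ _ (𝓝 (trace (A v * A v) - 2 * trace (U * diagonal σ * Uᵀ *
      ((1 - spectralProj U I) * A v * spectralProj U I *
        (pivot (spectralProj U I) (partialSum U σ I))⁻¹ *
        (spectralProj U I * A v * (1 - spectralProj U I)))))) at hlim
    rw [hAW] at hAQ hlim
    rw [hessianForm_eq_sum hU hσ hWs fun i hi j hj => apply_eq_zero_of_compress hU hAQ hi hj] at hlim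
    rw [dotProduct_hessianMatrix_mulVec, ← hW]
    refine snd_fderiv_apply_of_tendsto hf (hlim.congr fun t => ?_)
    rw [Function.comp_apply, Function.comp_apply, h.map_zero]
  -- `e` reads off the spectral entries with negative coefficient; on its kernel only nonnegative
  -- terms survive.
  let e : (Fin d → ℝ) →ₗ[ℝ] (D → ℝ) :=
    { toFun := fun v k => (Uᵀ * A (WithLp.toLp 2 v) * U) k.1.1 k.1.2
      map_add' := fun v w => by
        ext k
        rw [WithLp.toLp_add, map_add, mul_add, add_mul]
        rfl
      map_smul' := fun a v => by
        ext k
        rw [WithLp.toLp_smul, map_smul, mul_smul_comm, smul_mul_assoc]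
        rfl }
  -- `s` lifts to the chart the tangent vectors supported on D and its transpose; on them only
  -- negative terms survive.
  let s : (D → ℝ) →ₗ[ℝ] (Fin d → ℝ) :=
    (WithLp.linearEquiv 2 ℝ (Fin d → ℝ)).toLinearMap ∘ₗ B.toLinearMap ∘ₗ symmScatter U D
  rw [← Fintype.card_coe]
  refine numNegEigenvalues_eq_of_maps (isHermitian_hessianMatrix hf) e s ?_ ?_
  · intro v hv
    rw [← WithLp.ofLp_toLp 2 v, hq]
    refine mul_nonneg two_pos.le (Finset.sum_nonneg fun i _ => Finset.sum_nonneg fun j _ => ?_)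
    by_cases hij : (i, j) ∈ D
    · have : (Uᵀ * A (WithLp.toLp 2 v) * U) i j = 0 := congrFun hv ⟨(i, j), hij⟩
      simp [this]
    · refine mul_nonneg ?_ (sq_nonneg _)
      rw [hD] at hij
      simp only [c]
      split_ifs with hi hj
      · exact zero_le_one
      · have := not_lt.mp fun hlt => hij ⟨hi, hj, hlt⟩
        positivity
      · exact le_rfl
  · intro x hx
    have hDI : ∀ i j, (i, j) ∈ D → i ∈ I := fun i j hij => ((hD i j).mp hij).1
    have hAs : A (WithLp.toLp 2 (s x)) = symmScatter U D x :=
      hB _ (symmScatter_mem_tangentVectors hU hσ hDI x)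
    have hW : Uᵀ * A (WithLp.toLp 2 (s x)) * U = scatter D x + (scatter D x)ᵀ := by
      rw [hAs]; exact transpose_conj_conj hU _
    have hlast := hq (WithLp.toLp 2 (s x))
    rw [hW] at hlast
    -- Off D, either the row index is outside I and the coefficient is 0, or neither (i, j) nor (j,
    -- i) lies in D and the matrix entry is 0.
    have hterm : ∀ i j, (i, j) ∉ D → c i j * (scatter D x + (scatter D x)ᵀ) i j ^ 2 = 0 := by
      intro i j hij
      simp only [c]
      split_ifs with hi hj
      · have h1 : (j, i) ∉ D := fun h => ((hD j i).mp h).2.1 hi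
        simp [scatter_apply_of_notMem x h1, scatter_apply_of_notMem x hij]
      · have h1 : (j, i) ∉ D := fun h => hj ((hD j i).mp h).1
        simp [scatter_apply_of_notMem x h1, scatter_apply_of_notMem x hij]
      · simp
    have hterm' : ∀ k : D, c k.1.1 k.1.2 * (scatter D x + (scatter D x)ᵀ) k.1.1 k.1.2 ^ 2 =
        2 * (1 - σ k.1.2 / σ k.1.1) * x k ^ 2 := by
      rintro ⟨⟨i, j⟩, hij⟩
      obtain ⟨hi, hj, -⟩ := (hD i j).mp hij
      have h1 : (j, i) ∉ D := fun h => hj ((hD j i).mp h).1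
      simp [c, hi, hj, scatter_apply_of_notMem x h1, scatter_apply_of_mem x hij]
    change (WithLp.toLp 2 (s x)).ofLp ⬝ᵥ _ *ᵥ (WithLp.toLp 2 (s x)).ofLp < 0
    rw [hlast]
    refine mul_neg_of_pos_of_neg two_pos ?_
    rw [← Fintype.sum_prod_type' (f := fun i j =>
      c i j * (scatter D x + (scatter D x)ᵀ) i j ^ 2),
      ← Finset.sum_subset (Finset.subset_univ D) fun k _ hk => hterm k.1 k.2 hk,
      ← Finset.sum_coe_sort]
    simp only [hterm']
    have hcoef : ∀ k : D, 2 * (1 - σ k.1.2 / σ k.1.1) < 0 := fun k =>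
      mul_neg_of_pos_of_neg two_pos ((hD k.1.1 k.1.2).mp k.2).2.2
    obtain ⟨k, hk⟩ := Function.ne_iff.mp hx
    refine Finset.sum_neg' (fun k _ => mul_nonpos_of_nonpos_of_nonneg (hcoef k).le (sq_nonneg _))
      ⟨k, Finset.mem_univ _, mul_neg_of_neg_of_pos (hcoef k) (sq_pos_of_ne_zero hk)⟩

end SquaredDistance

end

end EckartYoung

theorem theorem4p5 (n r : ℕ) (T U : Matrix (Fin n) (Fin n) ℝ) (σ : Fin n → ℝ)
    (hT : T.IsSymm) (hrank : T.rank = n)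
    (hU : U ∈ Matrix.orthogonalGroup (Fin n) ℝ)
    (hdecomp : T = U * Matrix.diagonal σ * U.transpose)
    (hσ : Function.Injective σ) :
    {S | EckartYoung.IsCriticalPointOn (EckartYoung.sqDist T) (EckartYoung.symRank r n) S} =
        {S | ∃ I : Finset (Fin n), I.card = r ∧ S = EckartYoung.partialSum U σ I} ∧
    {S | EckartYoung.IsCriticalPointOn (EckartYoung.sqDist T)
        (EckartYoung.symRank r n) S}.ncard = n.choose r ∧
    ∀ I : Finset (Fin n), I.card = r →
      EckartYoung.HasMorseIndexOn (EckartYoung.sqDist T) (EckartYoung.symRank r n)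
        (EckartYoung.partialSum U σ I)
        ((I ×ˢ Iᶜ).filter fun p => 0 ≤ σ p.1 / σ p.2 ∧ σ p.1 / σ p.2 ≤ 1).card := by
  have hUt : U.transpose * U = 1 := by
    simpa [Matrix.star_eq_conjTranspose] using (Matrix.mem_orthogonalGroup_iff' (Fin n) ℝ).mp hU
  -- The rank of T counts the nonzero σ_i, so full rank leaves none equal to zero.
  have hσ0 : ∀ i, σ i ≠ 0 := by
    rw [hdecomp, EckartYoung.rank_conj hUt, Matrix.rank_diagonal, Fintype.card_subtype] at hrank
    have h1 : (Finset.univ.filter fun i => σ i ≠ 0) = Finset.univ := by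
      rw [← Finset.card_eq_iff_eq_univ, hrank, Fintype.card_fin]
    exact fun i => by simpa using h1.ge (Finset.mem_univ i)
  have hset : {S | EckartYoung.IsCriticalPointOn (EckartYoung.sqDist T)
      (EckartYoung.symRank r n) S} =
      {S | ∃ I : Finset (Fin n), I.card = r ∧ S = EckartYoung.partialSum U σ I} := by
    ext S
    rw [hdecomp]
    constructor
    · exact EckartYoung.exists_eq_partialSum_of_isCriticalPointOn hUt hσ0 hσ
    · rintro ⟨I, rfl, rfl⟩
      exact EckartYoung.isCriticalPointOn_partialSum hUt hσ0 I
  refine ⟨hset, ?_, ?_⟩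
  · have himg : {S | ∃ I : Finset (Fin n), I.card = r ∧ S = EckartYoung.partialSum U σ I} =
        EckartYoung.partialSum U σ '' (Finset.powersetCard r Finset.univ : Finset (Finset (Fin n))) := by
      ext S
      simp [Finset.mem_powersetCard, eq_comm]
    rw [hset, himg, Set.ncard_image_of_injective _ (EckartYoung.partialSum_injective hUt hσ0),
      Set.ncard_coe_finset, Finset.card_powersetCard, Finset.card_fin]
  · rintro I rfl
    refine ⟨EckartYoung.exists_isLocalParam (EckartYoung.spectralProj_mul_self hUt)
      EckartYoung.transpose_partialSum (EckartYoung.rank_spectralProj hUt I)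
      EckartYoung.transpose_partialSum (EckartYoung.spectralProj_mul_partialSum hUt)
      (EckartYoung.partialSum_mul_spectralProj hUt)
      (EckartYoung.isUnit_pivot_partialSum hUt hσ0), ?_⟩
    intro d O p hp
    rw [hdecomp]
    exact EckartYoung.numNegEigenvalues_hessianMatrix hUt hσ0 hσ hp
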